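/- Let $(\mathcal X,\mathcal F,\mu)$ be a probability space and let $\mathcal P$ be the set of probability densities with respect to $\mu$ that are positive $\mu$-a.s., densities that agree $\mu$-a.e. being identified. For $p\in\mathcal P$ write $\mathbb E_p(f)=\int_{\mathcal X} f\,p\,d\mu$. Let $\Phi_1(x)=\cosh x-1$, and let $$L^{\Phi_1}(p)=\{u:\mathcal X\to\mathbb R \text{ measurable}:\ \mathbb E_p(\Phi_1(\alpha u))<\infty\text{ for some }\alpha>0\}$$ be the associated Orlicz space, with the Luxemburg norm $\|u\|_{\Phi_1,p}=\inf\{k>0:\mathbb E_p(\Phi_1(u/k))\le 1\}$. Put $L^{\Phi_1}_0(p)=\{u\in L^{\Phi_1}(p):\mathbb E_p(u)=0\}$, $K_p(u)=\log\mathbb E_p(e^u)\in[0,+\infty]$ for $u\in L^{\Phi_1}_0(p)$, and $\operatorname{dom}K_p=\{u\in L_0^{\Phi_1}(p): K_p(u)<\infty\}$. The maximal exponential model at $p$ is $$\mathcal E(p)=\{e^{u-K_p(u)}p:\ u\in \operatorname{int}(\operatorname{dom}K_p)\}\subseteq\mathcal P,$$ where the interior is taken in $L_0^{\Phi_1}(p)$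 with respect to the Luxemburg norm. Two densities $p,q\in\mathcal P$ are connected by an open exponential arc if there is an open interval $I\supset[0,1]$ such that for every $\theta\in I$ some positive constant multiple of $p^{1-\theta}q^{\theta}$ belongs to $\mathcal P$. **Theorem.** Let $p,q\in\mathcal P$. The following statements are equivalent: 1. $q\in\mathcal E(p)$; 2. $q$ is connected to $p$ by an open exponential arc; 3. $\mathcal E(p)=\mathcal E(q)$; 4. $L^{\Phi_1}(p)=L^{\Phi_1}(q)$ (as sets); 5. $\log\frac qp\in L^{\Phi_1}(p)\cap L^{\Phi_1}(q)$; 6. there is $\varepsilon>0$ such that $\frac qp\in L^{1+\varepsilon}(p\,d\mu)$ and $\frac pq\in L^{1+\varepsilon}(q\,d\mu)$. -/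

import Mathlib

open MeasureTheory
open scoped ENNReal

namespace ExpModel

/-- Real-valued representatives of the probability densities with respect to `μ` that are
positive `μ`-almost surely. -/
def posDensities {X : Type*} [MeasurableSpace X] (μ : Measure X) : Set (X → ℝ) :=
  {p | Measurable p ∧ (∀ᵐ x ∂μ, 0 < p x) ∧ ∫⁻ x, ENNReal.ofReal (p x) ∂μ = 1}

/-- The probability measure `p · μ`; integration against it is the expectation `E_p`. -/
noncomputable def densMeasure {X : Type*} [MeasurableSpace X] (μ : Measure X) (p : X → ℝ) :
    Measure X :=
  μ.withDensity fun x => ENNReal.ofReal (p x)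

/-- The Orlicz space `L^Φ(ν)`. -/
def orliczSpace {X : Type*} [MeasurableSpace X] (Φ : ℝ → ℝ≥0∞) (ν : Measure X) :
    Set (X → ℝ) :=
  {u | Measurable u ∧ ∃ α : ℝ, 0 < α ∧ ∫⁻ x, Φ (α * u x) ∂ν < ∞}

/-- The Luxemburg norm on `L^Φ(ν)`. -/
noncomputable def luxemburgNorm {X : Type*} [MeasurableSpace X] (Φ : ℝ → ℝ≥0∞)
    (ν : Measure X) (u : X → ℝ) : ℝ :=
  sInf {k : ℝ | 0 < k ∧ ∫⁻ x, Φ (u x / k) ∂ν ≤ 1}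

/-- The Young function `cosh - 1`. -/
noncomputable def Phi1 (x : ℝ) : ℝ≥0∞ := ENNReal.ofReal (Real.cosh x - 1)

/-- The centred Orlicz space: the `u` in `L^{Φ₁}(p)` with `E_p u = 0`. The elements of
`L^{Φ₁}(p)` are integrable with respect to `p · μ`. -/
def centredOrlicz {X : Type*} [MeasurableSpace X] (μ : Measure X) (p : X → ℝ) :
    Set (X → ℝ) :=
  {u | u ∈ orliczSpace Phi1 (densMeasure μ p) ∧ ∫ x, u x ∂(densMeasure μ p) = 0}

/-- The cumulant generating functional `K_p(u) = log E_p(e^u)`, with value `⊤` when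
`E_p(e^u) = ∞`. -/
noncomputable def cumulant {X : Type*} [MeasurableSpace X] (μ : Measure X) (p u : X → ℝ) :
    EReal :=
  ENNReal.log (∫⁻ x, ENNReal.ofReal (Real.exp (u x)) ∂(densMeasure μ p))

/-- The proper domain of `K_p`. -/
def cumulantDom {X : Type*} [MeasurableSpace X] (μ : Measure X) (p : X → ℝ) : Set (X → ℝ) :=
  {u | u ∈ centredOrlicz μ p ∧ cumulant μ p u < ⊤}

/-- The interior of the proper domain of `K_p` in the centred Orlicz space with its Luxemburg
norm: the points around which some open ball of that space lies in the domain. -/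
def cumulantDomInterior {X : Type*} [MeasurableSpace X] (μ : Measure X) (p : X → ℝ) :
    Set (X → ℝ) :=
  {u | u ∈ cumulantDom μ p ∧ ∃ r : ℝ, 0 < r ∧ ∀ v ∈ centredOrlicz μ p,
    luxemburgNorm Phi1 (densMeasure μ p) (v - u) < r → v ∈ cumulantDom μ p}

/-- The maximal exponential model at `p`: the densities `e^{u - K_p(u)} p` with `u` in the
interior of the proper domain of `K_p`. Densities are identified when they agree `μ`-almost
everywhere, so all representatives in `posDensities μ` are included. -/
def maxExpModel {X : Type*} [MeasurableSpace X] (μ : Measure X) (p : X → ℝ) : Set (X → ℝ) :=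
  {q | q ∈ posDensities μ ∧ ∃ u ∈ cumulantDomInterior μ p,
    ∀ᵐ x ∂μ, q x = Real.exp (u x - (cumulant μ p u).toReal) * p x}

/-- `p` and `q` are connected by an open exponential arc: on an open interval containing
`[0, 1]`, a normalization of `p^(1-θ) q^θ` is a positive density. -/
def ConnectedByOpenExpArc {X : Type*} [MeasurableSpace X] (μ : Measure X) (p q : X → ℝ) :
    Prop :=
  ∃ I : Set ℝ, IsOpen I ∧ I.OrdConnected ∧ Set.Icc 0 1 ⊆ I ∧
    ∀ θ ∈ I, ∃ c : ℝ, 0 < c ∧ (fun x => c * (p x ^ (1 - θ) * q x ^ θ)) ∈ posDensities μ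

end ExpModel

/-! Put w = log(q/p). The hub is `HasExpMoments`: E_p e^{θw} is finite for some θ < 0 and some θ >
1. As q = e^w p, `lintegral_exp_change` gives E_q e^f = E_p e^{w+f}, so exchanging p and q replaces
θ by 1 - θ. Hence the conditions on arcs, on log(q/p) and on powers of the ratios are each a reading
of the hub. For the Orlicz spaces, a moment of order 1 + ε controls e^{w+a|u|} through the
Hölder-like bound `add_le_max_mul`. Conversely, w⁺ lies in L^{Φ₁}(p) and w⁻ in L^{Φ₁}(q) for every
pair, so equality of the spaces puts w in both. For the maximal model, the same bound makes w - E_p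
w an interior point of the domain; conversely, a ball around u contains (1+δ)u, which is a moment of
order above 1. Thus E(p) is the class of densities with the same Orlicz space as p, so equal spaces
give equal models. -/

namespace ExpModel

/-! ### Pointwise identities and inequalities -/

variable {X : Type*}

/-- The log-likelihood ratio of `q` with respect to `p`. -/
noncomputable def logRatio (p q : X → ℝ) (x : X) : ℝ := Real.log (q x / p x)

theorem logRatio_swap (p q : X → ℝ) (x : X) : logRatio q p x = -logRatio p q x := by
  rw [logRatio, logRatio, ← Real.log_inv, inv_div]

theorem exp_logRatio {p q : X → ℝ} {x : X} (hp : 0 < p x) (hq : 0 < q x) :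
    Real.exp (logRatio p q x) = q x / p x :=
  Real.exp_log (div_pos hq hp)

theorem rpow_mul_rpow_eq {p q : X → ℝ} {x : X} (hp : 0 < p x) (hq : 0 < q x) (θ : ℝ) :
    p x ^ (1 - θ) * q x ^ θ = p x * Real.exp (θ * logRatio p q x) := by
  rw [mul_comm θ, Real.exp_mul, exp_logRatio hp hq, Real.div_rpow hq.le hp.le,
    Real.rpow_sub hp, Real.rpow_one]
  ring

/-- Interpolation between exponents: moments at a and b control every moment in between. -/
theorem mul_le_max_mul {a b t : ℝ} (h1 : a ≤ t) (h2 : t ≤ b) (y : ℝ) :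
    t * y ≤ max (b * y) (a * y) := by
  rcases le_total 0 y with hy | hy
  · exact (mul_le_mul_of_nonneg_right h2 hy).trans (le_max_left _ _)
  · exact (mul_le_mul_of_nonpos_right h1 hy).trans (le_max_right _ _)

theorem mul_abs_eq_max {a : ℝ} (ha : 0 < a) (y : ℝ) : a * |y| = max (a * y) (-a * y) := by
  rw [← abs_of_pos ha, ← abs_mul, abs_of_pos ha, neg_mul]
  rfl

/-- The left side is the average of the two entries with weights 1/(1+ε) and ε/(1+ε). After
exponentiation this replaces Hölder with these conjugate exponents. -/
theorem add_le_max_mul {ε : ℝ} (hε : 0 < ε) (y z : ℝ) :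
    y + z ≤ max ((1 + ε) * y) ((1 + ε) / ε * z) := by
  rw [le_max_iff]
  by_contra! hc
  obtain ⟨h1, h2⟩ := hc
  rw [div_mul_eq_mul_div, div_lt_iff₀ hε] at h2
  nlinarith

/-! ### Exponential moments and the Orlicz space of cosh - 1 -/

variable [MeasurableSpace X]

/-- Finiteness of the exponential moment `∫ e^f dν`. -/
def FiniteExp (ν : Measure X) (f : X → ℝ) : Prop :=
  ∫⁻ x, ENNReal.ofReal (Real.exp (f x)) ∂ν < ∞

theorem FiniteExp.of_le_max {ν : Measure X} {f g h : X → ℝ} (hg : FiniteExp ν g)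
    (hh : FiniteExp ν h) (hgm : Measurable g) (hle : ∀ x, f x ≤ max (g x) (h x)) :
    FiniteExp ν f := by
  have hmono : ∫⁻ x, ENNReal.ofReal (Real.exp (f x)) ∂ν ≤
      ∫⁻ x, (ENNReal.ofReal (Real.exp (g x)) + ENNReal.ofReal (Real.exp (h x))) ∂ν := by
    refine lintegral_mono fun x => ?_
    rcases le_max_iff.1 (hle x) with hx | hx
    · exact (ENNReal.ofReal_le_ofReal (Real.exp_le_exp.2 hx)).trans le_self_add
    · exact (ENNReal.ofReal_le_ofReal (Real.exp_le_exp.2 hx)).trans le_add_self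
  rw [lintegral_add_left (by fun_prop)] at hmono
  exact hmono.trans_lt (ENNReal.add_lt_top.2 ⟨hg, hh⟩)

theorem FiniteExp.mono {ν : Measure X} {f g : X → ℝ} (hg : FiniteExp ν g)
    (hle : ∀ x, f x ≤ g x) : FiniteExp ν f :=
  (lintegral_mono fun x => ENNReal.ofReal_le_ofReal (Real.exp_le_exp.2 (hle x))).trans_lt hg

theorem finiteExp_const {ν : Measure X} [IsFiniteMeasure ν] (c : ℝ) :
    FiniteExp ν fun _ => c := by
  simp only [FiniteExp, lintegral_const]
  exact ENNReal.mul_lt_top ENNReal.ofReal_lt_top (measure_lt_top ν _)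

theorem FiniteExp.add_const {ν : Measure X} {f : X → ℝ} (hf : FiniteExp ν f) (c : ℝ) :
    FiniteExp ν fun x => f x + c := by
  have h : ∀ x, ENNReal.ofReal (Real.exp (f x + c)) =
      ENNReal.ofReal (Real.exp (f x)) * ENNReal.ofReal (Real.exp c) := fun x => by
    rw [Real.exp_add, ENNReal.ofReal_mul (Real.exp_pos _).le]
  simp only [FiniteExp, h, lintegral_mul_const' _ _ ENNReal.ofReal_ne_top]
  exact ENNReal.mul_lt_top hf ENNReal.ofReal_lt_top

theorem FiniteExp.of_phi1 {ν : Measure X} [IsFiniteMeasure ν] {f : X → ℝ}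
    (hf : ∫⁻ x, Phi1 (f x) ∂ν < ∞) : FiniteExp ν fun x => |f x| := by
  have hle : ∀ x, ENNReal.ofReal (Real.exp |f x|) ≤ 2 * Phi1 (f x) + 2 := fun x => by
    have h1 : Real.exp |f x| ≤ 2 * (Real.cosh (f x) - 1) + 2 := by
      rw [← Real.cosh_abs, Real.cosh_eq]
      linarith [Real.exp_pos (-|f x|)]
    have h2 : 0 ≤ Real.cosh (f x) - 1 := by linarith [Real.one_le_cosh (f x)]
    refine (ENNReal.ofReal_le_ofReal h1).trans (le_of_eq ?_)
    rw [ENNReal.ofReal_add (by positivity) (by norm_num), ENNReal.ofReal_mul (by norm_num)]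
    simp [Phi1]
  refine (lintegral_mono hle).trans_lt ?_
  rw [lintegral_add_right _ measurable_const, lintegral_const_mul' _ _ (by norm_num),
    lintegral_const]
  exact ENNReal.add_lt_top.2 ⟨ENNReal.mul_lt_top (by norm_num) hf,
    ENNReal.mul_lt_top (by norm_num) (measure_lt_top ν _)⟩

theorem FiniteExp.phi1 {ν : Measure X} {f : X → ℝ} (hf : FiniteExp ν fun x => |f x|) :
    ∫⁻ x, Phi1 (f x) ∂ν < ∞ := by
  refine (lintegral_mono fun x => ENNReal.ofReal_le_ofReal ?_).trans_lt hf
  rw [← Real.cosh_abs, Real.cosh_eq]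
  have : Real.exp (-|f x|) ≤ Real.exp |f x| :=
    Real.exp_le_exp.2 (by linarith [abs_nonneg (f x)])
  linarith

/-- On a finite measure Φ₁(y) and e^{|y|} are interchangeable, because Φ₁(y) ≤ e^{|y|} ≤ 2Φ₁(y) + 2.
-/
theorem mem_orliczSpace_phi1_iff {ν : Measure X} [IsFiniteMeasure ν] {u : X → ℝ} :
    u ∈ orliczSpace Phi1 ν ↔
      Measurable u ∧ ∃ α : ℝ, 0 < α ∧ FiniteExp ν fun x => α * |u x| := by
  refine and_congr_right fun _ => exists_congr fun α => and_congr_right fun hα => ?_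
  have h : ∀ x, α * |u x| = |α * u x| := fun x => by rw [abs_mul, abs_of_pos hα]
  simp only [h]
  exact ⟨FiniteExp.of_phi1, FiniteExp.phi1⟩

/-- Convexity and Φ₁(0) = 0 give Φ₁(sy) ≤ sΦ₁(y) for 0 ≤ s ≤ 1; s = 1/(1+c) brings an integral c
below 1. -/
theorem exists_lintegral_phi1_le_one {ν : Measure X} [IsFiniteMeasure ν] {u : X → ℝ}
    (hu : u ∈ orliczSpace Phi1 ν) : ∃ t : ℝ, 0 < t ∧ ∫⁻ x, Phi1 (t * u x) ∂ν ≤ 1 := by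
  obtain ⟨-, α, hα, hfin⟩ := hu
  set c := (∫⁻ x, Phi1 (α * u x) ∂ν).toReal
  have hc : 0 ≤ c := ENNReal.toReal_nonneg
  have hs : (1 + c)⁻¹ ≤ 1 := inv_le_one_of_one_le₀ (by linarith)
  have hs0 : 0 < (1 + c)⁻¹ := by positivity
  refine ⟨(1 + c)⁻¹ * α, by positivity, ?_⟩
  have hle : ∀ x, Phi1 ((1 + c)⁻¹ * α * u x) ≤
      ENNReal.ofReal (1 + c)⁻¹ * Phi1 (α * u x) := fun x => by
    rw [Phi1, Phi1, ← ENNReal.ofReal_mul hs0.le]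
    refine ENNReal.ofReal_le_ofReal ?_
    have hcv : ∀ y : ℝ, Real.exp ((1 + c)⁻¹ * y) ≤
        (1 + c)⁻¹ * Real.exp y + (1 - (1 + c)⁻¹) := fun y => by
      have := convexOn_exp.2 (Set.mem_univ y) (Set.mem_univ 0) hs0.le (sub_nonneg.2 hs)
        (by ring)
      simpa using this
    have h1 := hcv (α * u x)
    have h2 := hcv (-(α * u x))
    rw [Real.cosh_eq, Real.cosh_eq, mul_assoc]
    rw [mul_neg] at h2
    nlinarith
  refine (lintegral_mono hle).trans ?_
  rw [lintegral_const_mul' _ _ ENNReal.ofReal_ne_top, ← ENNReal.ofReal_toReal hfin.ne,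
    ← ENNReal.ofReal_mul hs0.le]
  refine ENNReal.ofReal_le_one.2 ?_
  change (1 + c)⁻¹ * c ≤ 1
  rw [inv_mul_le_iff₀ (by positivity)]
  linarith

theorem luxemburgNorm_le {ν : Measure X} {u : X → ℝ} {k : ℝ} (hk : 0 < k)
    (h : ∫⁻ x, Phi1 (u x / k) ∂ν ≤ 1) : luxemburgNorm Phi1 ν u ≤ k :=
  csInf_le ⟨0, fun _ ha => ha.1.le⟩ ⟨hk, h⟩

theorem exists_lt_of_luxemburgNorm_lt {ν : Measure X} [IsFiniteMeasure ν] {u : X → ℝ} {r : ℝ}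
    (hu : u ∈ orliczSpace Phi1 ν) (h : luxemburgNorm Phi1 ν u < r) :
    ∃ k : ℝ, 0 < k ∧ k < r ∧ ∫⁻ x, Phi1 (u x / k) ∂ν ≤ 1 := by
  obtain ⟨t, ht, hle⟩ := exists_lintegral_phi1_le_one hu
  -- Needed because the real `sInf` of the empty set is 0.
  have hne : {k : ℝ | 0 < k ∧ ∫⁻ x, Phi1 (u x / k) ∂ν ≤ 1}.Nonempty :=
    ⟨t⁻¹, inv_pos.2 ht, by simpa [div_inv_eq_mul, mul_comm] using hle⟩
  obtain ⟨k, ⟨hk, hk1⟩, hkr⟩ := exists_lt_of_csInf_lt hne h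
  exact ⟨k, hk, hkr, hk1⟩

theorem integrable_of_mem_orliczSpace {ν : Measure X} [IsFiniteMeasure ν] {u : X → ℝ}
    (hu : u ∈ orliczSpace Phi1 ν) : Integrable u ν := by
  obtain ⟨hm, α, hα, hfin⟩ := mem_orliczSpace_phi1_iff.1 hu
  have hint : Integrable (fun x => Real.exp (α * |u x|)) ν :=
    ⟨by fun_prop, (hasFiniteIntegral_iff_ofReal
      (.of_forall fun x => (Real.exp_pos _).le)).2 hfin⟩
  refine (hint.const_mul α⁻¹).mono' hm.aestronglyMeasurable (.of_forall fun x => ?_)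
  rw [Real.norm_eq_abs, le_inv_mul_iff₀ hα]
  linarith [Real.add_one_le_exp (α * |u x|)]

theorem sub_mem_orliczSpace {ν : Measure X} [IsFiniteMeasure ν] {u v : X → ℝ}
    (hu : u ∈ orliczSpace Phi1 ν) (hv : v ∈ orliczSpace Phi1 ν) :
    u - v ∈ orliczSpace Phi1 ν := by
  rw [mem_orliczSpace_phi1_iff] at *
  obtain ⟨hum, α, hα, hu⟩ := hu
  obtain ⟨hvm, β, hβ, hv⟩ := hv
  refine ⟨hum.sub hvm, min α β / 2, by positivity, hu.of_le_max hv (by fun_prop) fun x => ?_⟩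
  have h1 : min α β * |u x| ≤ α * |u x| := by gcongr; exact min_le_left _ _
  have h2 : min α β * |v x| ≤ β * |v x| := by gcongr; exact min_le_right _ _
  have h3 : min α β / 2 * |(u - v) x| ≤ min α β / 2 * (|u x| + |v x|) := by
    gcongr; exact abs_sub _ _
  rw [le_max_iff]
  by_contra! hc
  linarith

theorem const_mem_orliczSpace {ν : Measure X} [IsFiniteMeasure ν] (c : ℝ) :
    (fun _ => c) ∈ orliczSpace Phi1 ν :=
  mem_orliczSpace_phi1_iff.2 ⟨measurable_const, 1, one_pos, finiteExp_const _⟩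

theorem const_mul_mem_orliczSpace {ν : Measure X} [IsFiniteMeasure ν] {u : X → ℝ}
    (hu : u ∈ orliczSpace Phi1 ν) {c : ℝ} (hc : 0 < c) :
    (fun x => c * u x) ∈ orliczSpace Phi1 ν := by
  obtain ⟨hm, α, hα, h⟩ := hu
  refine ⟨hm.const_mul c, α / c, by positivity, ?_⟩
  have : ∀ x, α / c * (c * u x) = α * u x := fun x => by field_simp
  simpa only [this] using h

/-! ### Change of density -/

theorem isProbabilityMeasure_densMeasure {μ : Measure X} {p : X → ℝ} (hp : p ∈ posDensities μ) :
    IsProbabilityMeasure (densMeasure μ p) :=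
  ⟨by rw [densMeasure, withDensity_apply _ MeasurableSet.univ, setLIntegral_univ, hp.2.2]⟩

theorem ae_densMeasure {μ : Measure X} {p : X → ℝ} {s : X → Prop}
    (h : ∀ᵐ x ∂μ, s x) : ∀ᵐ x ∂(densMeasure μ p), s x :=
  (withDensity_absolutelyContinuous μ _).ae_le h

theorem measurable_logRatio {μ : Measure X} {p q : X → ℝ} (hp : p ∈ posDensities μ)
    (hq : q ∈ posDensities μ) : Measurable (logRatio p q) :=
  Real.measurable_log.comp (hq.1.div hp.1)

theorem lintegral_exp_densMeasure {μ : Measure X} {p f : X → ℝ} (hp : p ∈ posDensities μ)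
    (hf : Measurable f) :
    ∫⁻ x, ENNReal.ofReal (Real.exp (f x)) ∂(densMeasure μ p) =
      ∫⁻ x, ENNReal.ofReal (p x * Real.exp (f x)) ∂μ := by
  have hpm := hp.1
  rw [densMeasure, lintegral_withDensity_eq_lintegral_mul _ (by fun_prop) (by fun_prop)]
  refine lintegral_congr_ae ?_
  filter_upwards [hp.2.1] with x hx
  simp [ENNReal.ofReal_mul hx.le]

theorem lintegral_exp_change {μ : Measure X} {p q f : X → ℝ} (hp : p ∈ posDensities μ)
    (hq : q ∈ posDensities μ) (hf : Measurable f) :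
    ∫⁻ x, ENNReal.ofReal (Real.exp (f x)) ∂(densMeasure μ q) =
      ∫⁻ x, ENNReal.ofReal (Real.exp (logRatio p q x + f x)) ∂(densMeasure μ p) := by
  have hw := measurable_logRatio hp hq
  rw [lintegral_exp_densMeasure hp (by fun_prop), lintegral_exp_densMeasure hq hf]
  refine lintegral_congr_ae ?_
  filter_upwards [hp.2.1, hq.2.1] with x hpx hqx
  rw [Real.exp_add, exp_logRatio hpx hqx]
  congr 1
  field_simp

/-! ### The moment condition and its symmetry -/

/-- The densities `p` and `q` have a log-likelihood ratio `w` for which `E_p e^{θ w}` is finite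
at some `θ < 0` and some `θ > 1`. -/
def HasExpMoments (μ : Measure X) (p q : X → ℝ) : Prop :=
  ∃ ε : ℝ, 0 < ε ∧ FiniteExp (densMeasure μ p) (fun x => (1 + ε) * logRatio p q x) ∧
    FiniteExp (densMeasure μ p) (fun x => -ε * logRatio p q x)

theorem hasExpMoments_of_pos {μ : Measure X} {p q : X → ℝ} (hp : p ∈ posDensities μ)
    (hq : q ∈ posDensities μ) {α β : ℝ} (hα : 0 < α) (hβ : 0 < β)
    (h1 : FiniteExp (densMeasure μ p) (fun x => (1 + β) * logRatio p q x))
    (h2 : FiniteExp (densMeasure μ p) (fun x => -α * logRatio p q x)) :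
    HasExpMoments μ p q := by
  have hw := measurable_logRatio hp hq
  have hm := min_le_left α β
  have hm' := min_le_right α β
  have h0 : 0 < min α β := lt_min hα hβ
  exact ⟨min α β, h0,
    h1.of_le_max h2 (by fun_prop) fun x => mul_le_max_mul (by linarith) (by linarith) _,
    h1.of_le_max h2 (by fun_prop) fun x => mul_le_max_mul (by linarith) (by linarith) _⟩

/-- E_q e^{-θw} = E_p e^{(1-θ)w}, and θ ↦ 1 - θ swaps 1 + ε and -ε. -/
theorem HasExpMoments.symm {μ : Measure X} {p q : X → ℝ} (hp : p ∈ posDensities μ)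
    (hq : q ∈ posDensities μ) (h : HasExpMoments μ p q) : HasExpMoments μ q p := by
  have hw := measurable_logRatio hp hq
  obtain ⟨ε, hε, h1, h2⟩ := h
  refine ⟨ε, hε, ?_, ?_⟩
  · simp only [FiniteExp, logRatio_swap p q]
    rw [lintegral_exp_change hp hq (by fun_prop)]
    exact h2.mono fun x => by linarith
  · simp only [FiniteExp, logRatio_swap p q]
    rw [lintegral_exp_change hp hq (by fun_prop)]
    exact h1.mono fun x => by linarith

/-! ### Powers of the density ratios -/

theorem memLp_ratio_iff {μ : Measure X} {p q : X → ℝ} (hp : p ∈ posDensities μ)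
    (hq : q ∈ posDensities μ) {ε : ℝ} (hε : 0 < ε) :
    MemLp (fun x => q x / p x) (ENNReal.ofReal (1 + ε)) (densMeasure μ p) ↔
      FiniteExp (densMeasure μ p) (fun x => (1 + ε) * logRatio p q x) := by
  have h0 : ENNReal.ofReal (1 + ε) ≠ 0 := by simp; linarith
  have hm : AEStronglyMeasurable (fun x => q x / p x) (densMeasure μ p) :=
    (hq.1.div hp.1).aestronglyMeasurable
  have heq : ∫⁻ x, ‖q x / p x‖ₑ ^ (ENNReal.ofReal (1 + ε)).toReal ∂(densMeasure μ p) =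
      ∫⁻ x, ENNReal.ofReal (Real.exp ((1 + ε) * logRatio p q x)) ∂(densMeasure μ p) := by
    refine lintegral_congr_ae (ae_densMeasure ?_)
    filter_upwards [hp.2.1, hq.2.1] with x hpx hqx
    have hr := div_pos hqx hpx
    rw [ENNReal.toReal_ofReal (by linarith), Real.enorm_eq_ofReal hr.le,
      ENNReal.ofReal_rpow_of_pos hr, mul_comm, Real.exp_mul, exp_logRatio hpx hqx]
  rw [MemLp, and_iff_right hm,
    eLpNorm_lt_top_iff_lintegral_rpow_enorm_lt_top h0 ENNReal.ofReal_ne_top, heq, FiniteExp]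

theorem hasExpMoments_iff_memLp {μ : Measure X} {p q : X → ℝ} (hp : p ∈ posDensities μ)
    (hq : q ∈ posDensities μ) :
    HasExpMoments μ p q ↔ ∃ ε : ℝ, 0 < ε ∧
      MemLp (fun x => q x / p x) (ENNReal.ofReal (1 + ε)) (densMeasure μ p) ∧
      MemLp (fun x => p x / q x) (ENNReal.ofReal (1 + ε)) (densMeasure μ q) := by
  have hw := measurable_logRatio hp hq
  refine exists_congr fun ε => and_congr_right fun hε => ?_
  rw [memLp_ratio_iff hp hq hε, memLp_ratio_iff hq hp hε]
  refine and_congr_right fun _ => ?_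
  simp only [FiniteExp, logRatio_swap p q]
  rw [lintegral_exp_change hp hq (by fun_prop)]
  have : ∀ x, logRatio p q x + (1 + ε) * -logRatio p q x = -ε * logRatio p q x :=
    fun x => by ring
  simp only [this]

/-! ### Open exponential arcs -/

theorem lintegral_arc {μ : Measure X} {p q : X → ℝ} (hp : p ∈ posDensities μ)
    (hq : q ∈ posDensities μ) {c : ℝ} (hc : 0 < c) (θ : ℝ) :
    ∫⁻ x, ENNReal.ofReal (c * (p x ^ (1 - θ) * q x ^ θ)) ∂μ = ENNReal.ofReal c *
      ∫⁻ x, ENNReal.ofReal (Real.exp (θ * logRatio p q x)) ∂(densMeasure μ p) := by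
  have hw := measurable_logRatio hp hq
  rw [lintegral_exp_densMeasure hp (by fun_prop),
    ← lintegral_const_mul' _ _ ENNReal.ofReal_ne_top]
  refine lintegral_congr_ae ?_
  filter_upwards [hp.2.1, hq.2.1] with x hpx hqx
  rw [rpow_mul_rpow_eq hpx hqx, ENNReal.ofReal_mul hc.le]

theorem hasExpMoments_iff_connected {μ : Measure X} {p q : X → ℝ} (hp : p ∈ posDensities μ)
    (hq : q ∈ posDensities μ) : HasExpMoments μ p q ↔ ConnectedByOpenExpArc μ p q := by
  have hw := measurable_logRatio hp hq
  have := isProbabilityMeasure_densMeasure hp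
  constructor
  · rintro ⟨ε, hε, h1, h2⟩
    refine ⟨Set.Ioo (-ε) (1 + ε), isOpen_Ioo, Set.ordConnected_Ioo,
      fun x hx => ⟨by linarith [hx.1], by linarith [hx.2]⟩, fun θ hθ => ?_⟩
    have hfin : FiniteExp (densMeasure μ p) fun x => θ * logRatio p q x :=
      h1.of_le_max h2 (by fun_prop) fun x => mul_le_max_mul hθ.1.le hθ.2.le _
    set J := ∫⁻ x, ENNReal.ofReal (Real.exp (θ * logRatio p q x)) ∂(densMeasure μ p) with hJ
    have hJ0 : J ≠ 0 := by
      rw [hJ, ← pos_iff_ne_zero, lintegral_pos_iff_support (by fun_prop)]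
      have : (Function.support fun x => ENNReal.ofReal (Real.exp (θ * logRatio p q x))) =
          Set.univ := by
        ext x; simp [Real.exp_pos]
      simp [this]
    have hc : 0 < J.toReal⁻¹ := inv_pos.2 (ENNReal.toReal_pos hJ0 hfin.ne)
    refine ⟨J.toReal⁻¹, hc, ?_, ?_, ?_⟩
    · exact ((hp.1.pow_const _).mul (hq.1.pow_const _)).const_mul _
    · filter_upwards [hp.2.1, hq.2.1] with x hpx hqx
      positivity
    · rw [lintegral_arc hp hq hc, ← hJ, ENNReal.ofReal_inv_of_pos (inv_pos.1 hc),
        ENNReal.ofReal_toReal hfin.ne, ENNReal.inv_mul_cancel hJ0 hfin.ne]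
  · rintro ⟨I, hI, -, hsub, harc⟩
    have hfin : ∀ θ ∈ I, FiniteExp (densMeasure μ p) fun x => θ * logRatio p q x := by
      intro θ hθ
      obtain ⟨c, hc, -, -, h1⟩ := harc θ hθ
      rw [lintegral_arc hp hq hc] at h1
      refine lt_top_iff_ne_top.2 fun htop => ?_
      rw [htop, ENNReal.mul_top (by simpa using hc)] at h1
      exact ENNReal.top_ne_one h1
    -- Openness at the endpoints 0 and 1 supplies the exponents -α/2 and 1 + β/2.
    obtain ⟨α, hα, hα'⟩ := Metric.isOpen_iff.1 hI 0 (hsub (by simp))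
    obtain ⟨β, hβ, hβ'⟩ := Metric.isOpen_iff.1 hI 1 (hsub (by simp))
    refine hasExpMoments_of_pos hp hq (half_pos hα) (half_pos hβ) (hfin _ (hβ' ?_))
      (hfin _ (hα' ?_))
    · rw [Metric.mem_ball, Real.dist_eq, add_sub_cancel_left, abs_of_pos (half_pos hβ)]
      linarith
    · rw [Metric.mem_ball, Real.dist_eq, sub_zero, abs_neg, abs_of_pos (half_pos hα)]
      linarith

/-! ### The log-likelihood ratio and equality of Orlicz spaces -/

theorem hasExpMoments_of_logRatio_mem {μ : Measure X} {p q : X → ℝ} (hp : p ∈ posDensities μ)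
    (hq : q ∈ posDensities μ) (h1 : logRatio p q ∈ orliczSpace Phi1 (densMeasure μ p))
    (h2 : logRatio p q ∈ orliczSpace Phi1 (densMeasure μ q)) : HasExpMoments μ p q := by
  have := isProbabilityMeasure_densMeasure hp
  have := isProbabilityMeasure_densMeasure hq
  obtain ⟨hw, α, hα, h1⟩ := mem_orliczSpace_phi1_iff.1 h1
  obtain ⟨-, β, hβ, h2⟩ := mem_orliczSpace_phi1_iff.1 h2
  refine hasExpMoments_of_pos hp hq hα hβ ?_ (h1.mono fun x => ?_)
  · rw [FiniteExp, lintegral_exp_change hp hq (by fun_prop)] at h2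
    refine FiniteExp.mono h2 fun x => ?_
    nlinarith [le_abs_self (logRatio p q x)]
  · rw [mul_abs_eq_max hα]
    exact le_max_right _ _

theorem HasExpMoments.logRatio_mem {μ : Measure X} {p q : X → ℝ} (hp : p ∈ posDensities μ)
    (hq : q ∈ posDensities μ) (h : HasExpMoments μ p q) :
    logRatio p q ∈ orliczSpace Phi1 (densMeasure μ p) := by
  have := isProbabilityMeasure_densMeasure hp
  have hw := measurable_logRatio hp hq
  obtain ⟨ε, hε, h1, h2⟩ := h
  refine mem_orliczSpace_phi1_iff.2 ⟨hw, ε, hε, h1.of_le_max h2 (by fun_prop) fun x => ?_⟩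
  rw [mul_abs_eq_max hε]
  exact max_le (mul_le_max_mul (by linarith) (by linarith) _) (le_max_right _ _)

theorem neg_mem_orliczSpace {ν : Measure X} {u : X → ℝ}
    (hu : u ∈ orliczSpace Phi1 ν) : (fun x => -u x) ∈ orliczSpace Phi1 ν := by
  obtain ⟨hm, α, hα, h⟩ := hu
  refine ⟨hm.neg, α, hα, ?_⟩
  simpa only [Phi1, mul_neg, Real.cosh_neg] using h

theorem HasExpMoments.logRatio_mem_right {μ : Measure X} {p q : X → ℝ}
    (hp : p ∈ posDensities μ) (hq : q ∈ posDensities μ) (h : HasExpMoments μ p q) :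
    logRatio p q ∈ orliczSpace Phi1 (densMeasure μ q) := by
  have := neg_mem_orliczSpace ((h.symm hp hq).logRatio_mem hq hp)
  simpa only [← logRatio_swap] using this

theorem HasExpMoments.orliczSpace_subset {μ : Measure X} {p q : X → ℝ}
    (hp : p ∈ posDensities μ) (hq : q ∈ posDensities μ) (h : HasExpMoments μ p q) :
    orliczSpace Phi1 (densMeasure μ p) ⊆ orliczSpace Phi1 (densMeasure μ q) := by
  have := isProbabilityMeasure_densMeasure hp
  have := isProbabilityMeasure_densMeasure hq
  have hw := measurable_logRatio hp hq
  obtain ⟨ε, hε, h1, -⟩ := h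
  intro u hu
  obtain ⟨hum, α, hα, hu⟩ := mem_orliczSpace_phi1_iff.1 hu
  -- Chosen so that the factor (1+ε)/ε from `add_le_max_mul` restores α.
  refine mem_orliczSpace_phi1_iff.2 ⟨hum, α / ((1 + ε) / ε), by positivity, ?_⟩
  rw [FiniteExp, lintegral_exp_change hp hq (by fun_prop)]
  refine h1.of_le_max hu (by fun_prop) fun x => (add_le_max_mul hε _ _).trans_eq ?_
  congr 1
  field_simp

/-- No relation between p and q is needed: e^{w⁺} ≤ e^w + 1 and E_p e^w = E_q 1 = 1. -/
theorem max_logRatio_mem {μ : Measure X} {p q : X → ℝ} (hp : p ∈ posDensities μ)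
    (hq : q ∈ posDensities μ) :
    (fun x => max (logRatio p q x) 0) ∈ orliczSpace Phi1 (densMeasure μ p) := by
  have := isProbabilityMeasure_densMeasure hp
  have := isProbabilityMeasure_densMeasure hq
  have hw := measurable_logRatio hp hq
  have h1 : FiniteExp (densMeasure μ p) (logRatio p q) := by
    have := finiteExp_const (ν := densMeasure μ q) 0
    rw [FiniteExp, lintegral_exp_change hp hq measurable_const] at this
    exact FiniteExp.mono this fun x => by simp
  refine mem_orliczSpace_phi1_iff.2 ⟨by fun_prop, 1, one_pos,
    h1.of_le_max (finiteExp_const 0) hw fun x => ?_⟩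
  rw [one_mul, abs_of_nonneg (le_max_right _ _)]

theorem hasExpMoments_iff_orliczSpace_eq {μ : Measure X} {p q : X → ℝ}
    (hp : p ∈ posDensities μ) (hq : q ∈ posDensities μ) :
    HasExpMoments μ p q ↔
      orliczSpace Phi1 (densMeasure μ p) = orliczSpace Phi1 (densMeasure μ q) := by
  refine ⟨fun h => (h.orliczSpace_subset hp hq).antisymm
    ((h.symm hp hq).orliczSpace_subset hq hp), fun h => ?_⟩
  have := isProbabilityMeasure_densMeasure hp
  have h1 := max_logRatio_mem hp hq
  have h2 := max_logRatio_mem hq hp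
  rw [← h] at h2
  -- w = w⁺ - w⁻, where w⁻ is the positive part of log(p/q).
  have hw : logRatio p q ∈ orliczSpace Phi1 (densMeasure μ p) := by
    convert sub_mem_orliczSpace h1 h2 using 1
    ext x
    rw [Pi.sub_apply, logRatio_swap p q, max_comm, max_comm (-_)]
    exact (max_zero_sub_max_neg_zero_eq_self _).symm.trans (by rw [max_comm, max_comm (-_)])
  exact hasExpMoments_of_logRatio_mem hp hq hw (h ▸ hw)

/-! ### The maximal exponential model -/

theorem hasExpMoments_of_mem_maxExpModel {μ : Measure X} {p q : X → ℝ}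
    (hp : p ∈ posDensities μ) (h : q ∈ maxExpModel μ p) : HasExpMoments μ p q := by
  have := isProbabilityMeasure_densMeasure hp
  obtain ⟨hq, u, ⟨⟨⟨hu, hu0⟩, -⟩, r, hr, hball⟩, heq⟩ := h
  set K := (cumulant μ p u).toReal
  have hw : ∀ᵐ x ∂(densMeasure μ p), logRatio p q x = u x - K := by
    refine ae_densMeasure ?_
    filter_upwards [hp.2.1, heq] with x hpx hx
    rw [logRatio, hx, mul_div_cancel_right₀ _ hpx.ne', Real.log_exp]
  have hcongr : ∀ θ : ℝ, FiniteExp (densMeasure μ p) (fun x => θ * u x) →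
      FiniteExp (densMeasure μ p) fun x => θ * logRatio p q x := by
    intro θ hθ
    refine lt_of_eq_of_lt (lintegral_congr_ae ?_) (hθ.add_const (-(θ * K)))
    filter_upwards [hw] with x hx
    rw [hx]
    congr 2
    ring
  obtain ⟨t, ht, hle⟩ := exists_lintegral_phi1_le_one hu
  obtain ⟨-, α, hα, hfin⟩ := mem_orliczSpace_phi1_iff.1 hu
  have hδ : 0 < t * r / 2 := by positivity
  -- The increment (tr/2)u has norm at most r/2, since E_p Φ₁(tu) ≤ 1. So the dilate stays in the
  -- ball.
  have hmem : (fun x => (1 + t * r / 2) * u x) ∈ cumulantDom μ p := by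
    refine hball _ ⟨const_mul_mem_orliczSpace hu (by positivity), ?_⟩ ?_
    · rw [integral_const_mul, hu0, mul_zero]
    · refine (luxemburgNorm_le (half_pos hr) (le_of_eq_of_le ?_ hle)).trans_lt (half_lt_self hr)
      refine lintegral_congr fun x => ?_
      congr 1
      simp only [Pi.sub_apply]
      field_simp
      ring
  refine hasExpMoments_of_pos hp hq hα hδ (hcongr _ ?_) (hcongr _ (hfin.mono fun x => ?_))
  · exact ENNReal.log_lt_top_iff.1 hmem.2
  · rw [mul_abs_eq_max hα]
    exact le_max_right _ _

theorem HasExpMoments.mem_maxExpModel {μ : Measure X} {p q : X → ℝ} (hp : p ∈ posDensities μ)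
    (hq : q ∈ posDensities μ) (h : HasExpMoments μ p q) : q ∈ maxExpModel μ p := by
  have := isProbabilityMeasure_densMeasure hp
  have := isProbabilityMeasure_densMeasure hq
  have hwm := measurable_logRatio hp hq
  have hw := h.logRatio_mem hp hq
  obtain ⟨ε, hε, h1, -⟩ := h
  set m := ∫ x, logRatio p q x ∂(densMeasure μ p) with hm
  set u : X → ℝ := logRatio p q - fun _ => m with hu
  have hux : ∀ x, u x = logRatio p q x - m := fun x => rfl
  have huL : u ∈ centredOrlicz μ p := by
    refine ⟨sub_mem_orliczSpace hw (const_mem_orliczSpace m), ?_⟩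
    simp only [hux]
    rw [integral_sub (integrable_of_mem_orliczSpace hw) (integrable_const _)]
    simp [hm]
  -- E_p e^{w-m} = e^{-m} E_q 1 = e^{-m}.
  have hK : cumulant μ p u = ((-m : ℝ) : EReal) := by
    have := lintegral_exp_change hp hq (f := fun _ => -m) measurable_const
    simp only [← sub_eq_add_neg, ← hux, lintegral_const, measure_univ, mul_one] at this
    rw [cumulant, ← this, ENNReal.log_ofReal_of_pos (Real.exp_pos _), Real.log_exp]
  have hudom : u ∈ cumulantDom μ p := ⟨huL, hK ▸ EReal.coe_lt_top _⟩
  have hau : FiniteExp (densMeasure μ p) fun x => (1 + ε) * u x :=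
    (h1.add_const (-((1 + ε) * m))).mono fun x => by rw [hux]; linarith
  -- Splitting v = u + (v - u) costs moments of (1+ε)u and of ((1+ε)/ε)(v - u). This radius makes
  -- the second finite.
  refine ⟨hq, u, ⟨hudom, ((1 + ε) / ε)⁻¹, by positivity, fun v hv hvr => ⟨hv, ?_⟩⟩, ?_⟩
  · obtain ⟨k, hk, hkr, hle⟩ :=
      exists_lt_of_luxemburgNorm_lt (sub_mem_orliczSpace hv.1 huL.1) hvr
    have hexp := FiniteExp.of_phi1 (hle.trans_lt ENNReal.one_lt_top)
    refine ENNReal.log_lt_top_iff.2 (hau.of_le_max hexp ?_ fun x => ?_)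
    · simp only [hux]; fun_prop
    · have h2 := add_le_max_mul hε (u x) ((v - u) x)
      rw [Pi.sub_apply, add_sub_cancel] at h2
      refine h2.trans (max_le_max le_rfl ?_)
      rw [abs_div, abs_of_pos hk, div_eq_inv_mul _ k, Pi.sub_apply]
      have hk' : (1 + ε) / ε ≤ k⁻¹ := by
        rw [le_inv_comm₀ (by positivity) hk]; exact hkr.le
      calc (1 + ε) / ε * (v x - u x) ≤ (1 + ε) / ε * |v x - u x| := by
            gcongr; exact le_abs_self _
        _ ≤ k⁻¹ * |v x - u x| := by gcongr
  · filter_upwards [hp.2.1, hq.2.1] with x hpx hqx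
    rw [hK, EReal.toReal_coe, hux, sub_neg_eq_add, sub_add_cancel, exp_logRatio hpx hqx,
      div_mul_cancel₀ _ hpx.ne']

/-- Exhibits maximal models as classes of an equivalence relation, from which both directions of the
equality of models follow. -/
theorem mem_maxExpModel_iff {μ : Measure X} {p q : X → ℝ} (hp : p ∈ posDensities μ) :
    q ∈ maxExpModel μ p ↔ q ∈ posDensities μ ∧
      orliczSpace Phi1 (densMeasure μ p) = orliczSpace Phi1 (densMeasure μ q) := by
  constructor
  · intro h
    exact ⟨h.1, (hasExpMoments_iff_orliczSpace_eq hp h.1).1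
      (hasExpMoments_of_mem_maxExpModel hp h)⟩
  · rintro ⟨hq, h⟩
    exact ((hasExpMoments_iff_orliczSpace_eq hp hq).2 h).mem_maxExpModel hp hq

end ExpModel

theorem theorem4p7 {X : Type*} [MeasurableSpace X] (μ : Measure X) [IsProbabilityMeasure μ]
    (p q : X → ℝ) (hp : p ∈ ExpModel.posDensities μ) (hq : q ∈ ExpModel.posDensities μ) :
    List.TFAE [
      q ∈ ExpModel.maxExpModel μ p,
      ExpModel.ConnectedByOpenExpArc μ p q,
      ExpModel.maxExpModel μ p = ExpModel.maxExpModel μ q,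
      ExpModel.orliczSpace ExpModel.Phi1 (ExpModel.densMeasure μ p) =
        ExpModel.orliczSpace ExpModel.Phi1 (ExpModel.densMeasure μ q),
      (fun x => Real.log (q x / p x)) ∈
        ExpModel.orliczSpace ExpModel.Phi1 (ExpModel.densMeasure μ p) ∩
          ExpModel.orliczSpace ExpModel.Phi1 (ExpModel.densMeasure μ q),
      ∃ ε : ℝ, 0 < ε ∧
        MemLp (fun x => q x / p x) (ENNReal.ofReal (1 + ε)) (ExpModel.densMeasure μ p) ∧
        MemLp (fun x => p x / q x) (ENNReal.ofReal (1 + ε)) (ExpModel.densMeasure μ q)] := by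
  open ExpModel in
  have h41 : orliczSpace Phi1 (densMeasure μ p) = orliczSpace Phi1 (densMeasure μ q) ↔
      q ∈ maxExpModel μ p := by
    rw [mem_maxExpModel_iff hp, and_iff_right hq]
  tfae_have 4 ↔ 1 := h41
  tfae_have 4 ↔ 2 := by
    rw [← ExpModel.hasExpMoments_iff_orliczSpace_eq hp hq,
      ExpModel.hasExpMoments_iff_connected hp hq]
  tfae_have 4 ↔ 6 := by
    rw [← ExpModel.hasExpMoments_iff_orliczSpace_eq hp hq,
      ExpModel.hasExpMoments_iff_memLp hp hq]
  tfae_have 4 ↔ 5 := by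
    rw [← ExpModel.hasExpMoments_iff_orliczSpace_eq hp hq]
    exact ⟨fun h => ⟨h.logRatio_mem hp hq, h.logRatio_mem_right hp hq⟩,
      fun h => ExpModel.hasExpMoments_of_logRatio_mem hp hq h.1 h.2⟩
  tfae_have 4 → 3 := fun h => by
    ext r
    rw [ExpModel.mem_maxExpModel_iff hp, ExpModel.mem_maxExpModel_iff hq, h]
  tfae_have 3 → 1 := fun h => by
    rw [h, ExpModel.mem_maxExpModel_iff hq]
    exact ⟨hq, rfl⟩
  tfae_finish
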